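/- Rings are associative with unit, and modules are unital right modules. A \emph{Noetherian algebra} is a ring that is an algebra over some commutative noetherian ring $K$ and finitely generated as a $K$-module. A right $A$-module $X$ is a \emph{generator} if there is an $A$-linear epimorphism $X^n\twoheadrightarrow A$ for some $n$; its trace ideal is $\tau_X(A)=\sum_{f\in\operatorname{Hom}_A(X,A)} f(X)\subseteq A$; and its grade is $\operatorname{grade}_A X=\inf\{i\ge 0\mid \operatorname{Ext}^i_A(X,A)\neq 0\}\in\mathbb{N}\cup\{\infty\}$. A module $N$ over a ring $B$ is a \emph{Wedderburn projective} if it is finitely generated projective and the natural ring homomorphism $B\to\operatorname{End}_{\operatorname{End}_B(N)}(\operatorname{Hom}_B(N,B))$ is an isomorphism. A \emph{Wedderburn context} is a pair $(C,e)$ of a ring $C$ and an idempotent $e\in C$ such that $C/C(1-e)C=0$ and $\operatorname{grade}_C(C/CeC)\ge 2$. Consider the following assertions. (SNC) For every Noetherian algebra $A$ and every finitely generated $A$-module $M$: if $\operatorname{Ext}^i_A(M,A)=0$ for all $i\ge 0$, then $M=0$. (INC$'$) For every Noetherian algebra $B$ and every Wedderburn projective $N$ over $B$: if $\operatorname{Ext}^i_B(B/\tau_N(B),B)=0$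 for all $i\ge 0$, then $N$ is a generator. (INC) For every Wedderburn context $(C,e)$ with $C$ a Noetherian algebra: if $\operatorname{Ext}^i_C(C/CeC,C)=0$ for all $i\ge 0$, then $C/CeC=0$. (GNC) For every Noetherian algebra $A$ and every finitely generated $A$-generator $M$: if $\operatorname{Ext}^i_A(M,M)=0$ for all $i>0$, then $M$ is projective. Then (SNC) implies (INC$'$), (INC$'$) is equivalent to (INC), and (INC) is equivalent to (GNC). -/

import Mathlib

open CategoryTheory

universe u

namespace NakayamaConjectures

/-! Modules are right modules: a right `A`-module is a module over `Aᵐᵒᵖ`, and `A` itself carries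
the right module structure given by multiplication on the right. -/

/-- A Noetherian algebra: a ring that is an algebra over some commutative noetherian ring and
finitely generated as a module over it. -/
def IsNoetherianAlgebra (A : Type u) [Ring A] : Prop :=
  ∃ (K : Type u) (_ : CommRing K) (_ : Algebra K A), IsNoetherianRing K ∧ Module.Finite K A

/-- The group `Ext^i_A(X, Y)` of right `A`-modules `X` and `Y`. -/
abbrev RightExt (A : Type u) [Ring A] (X Y : Type u) [AddCommGroup X] [Module Aᵐᵒᵖ X]
    [AddCommGroup Y] [Module Aᵐᵒᵖ Y] (i : ℕ) : Type u :=
  Abelian.Ext.{u} (ModuleCat.of Aᵐᵒᵖ X) (ModuleCat.of Aᵐᵒᵖ Y) i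

/-- The grade of a right `A`-module `X`, that is `inf {i ≥ 0 | Ext^i_A(X, A) ≠ 0}`, which is `⊤`
if all these groups vanish. -/
noncomputable def grade (A : Type u) [Ring A] (X : Type u) [AddCommGroup X] [Module Aᵐᵒᵖ X] :
    ℕ∞ :=
  ⨅ (i : ℕ) (_ : Nontrivial (RightExt A X A i)), (i : ℕ∞)

/-- A right `A`-module `X` is a generator if there is an epimorphism `X^n → A` for some `n`. -/
def IsGenerator (A : Type u) [Ring A] (X : Type u) [AddCommGroup X] [Module Aᵐᵒᵖ X] : Prop :=
  ∃ (n : ℕ) (f : (Fin n → X) →ₗ[Aᵐᵒᵖ] A), Function.Surjective f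

/-- The trace ideal `τ_X(A)` of a right `A`-module `X`, as a right ideal of `A`: the sum of the
images of all `A`-linear maps `X → A`. -/
def traceIdeal (A : Type u) [Ring A] (X : Type u) [AddCommGroup X] [Module Aᵐᵒᵖ X] :
    Submodule Aᵐᵒᵖ A :=
  ⨆ f : X →ₗ[Aᵐᵒᵖ] A, LinearMap.range f

/-- The natural ring homomorphism `R → End_{End_R(P)}(Hom_R(P, R))` for a right `R`-module `P`.
Here `Hom_R(P, R)` is a right `End_R(P)`-module by precomposition (written as a module over the
opposite ring `(End_R(P))ᵈᵐᵃ`), and `r : R` acts on it by `f ↦ (p ↦ r * f p)`. -/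
def doubleCentralizerMap (R : Type u) [Ring R] (P : Type u) [AddCommGroup P] [Module Rᵐᵒᵖ P] :
    R →+* Module.End (Module.End Rᵐᵒᵖ P)ᵈᵐᵃ (P →ₗ[Rᵐᵒᵖ] R) where
  toFun r :=
    { toFun := fun f =>
        { toFun := fun p => r * f p
          map_add' := fun p q => by simp [mul_add]
          map_smul' := fun s p => by simp [mul_assoc] }
      map_add' := fun f g => by ext p; simp [mul_add]
      map_smul' := fun c f => by ext p; rfl }
  map_one' := by ext f p; simp
  map_mul' r s := by ext f p; simp [mul_assoc]
  map_zero' := by ext f p; simp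
  map_add' r s := by ext f p; simp [add_mul]

/-- A right `R`-module `P` is a Wedderburn projective if it is finitely generated projective and
the natural ring homomorphism `R → End_{End_R(P)}(Hom_R(P, R))` is an isomorphism. -/
structure IsWedderburnProjective (R : Type u) [Ring R] (P : Type u) [AddCommGroup P]
    [Module Rᵐᵒᵖ P] : Prop where
  finite : Module.Finite Rᵐᵒᵖ P
  projective : Module.Projective Rᵐᵒᵖ P
  bijective : Function.Bijective (doubleCentralizerMap R P)

/-- The two-sided ideal `CeC` of `C`, regarded as a right ideal. -/
def idealOf {C : Type u} [Ring C] (e : C) : Submodule Cᵐᵒᵖ C :=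
  Submodule.span Cᵐᵒᵖ {x | ∃ a b : C, x = a * e * b}

/-- The Morita defect `C/CeC`, as a right `C`-module. For an idempotent `e`, the two Morita defects
of the Morita context `(C, e)` are `MoritaDefect e` and `MoritaDefect (1 - e)`. -/
abbrev MoritaDefect {C : Type u} [Ring C] (e : C) : Type u :=
  C ⧸ idealOf e

/-- A Wedderburn context: a ring `C` with an idempotent `e`, such that `C/C(1-e)C` vanishes and
the right `C`-module `C/CeC` has grade at least two. -/
structure IsWedderburnContext {C : Type u} [Ring C] (e : C) : Prop where
  idempotent : IsIdempotentElem e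
  defect_compl : Subsingleton (MoritaDefect (1 - e))
  two_le_grade : 2 ≤ grade C (MoritaDefect e)

/-- The Strong Nakayama Conjecture (SNC). -/
def StrongNakayama : Prop :=
  ∀ (A : Type u) [Ring A], IsNoetherianAlgebra A →
    ∀ (M : Type u) [AddCommGroup M] [Module Aᵐᵒᵖ M], Module.Finite Aᵐᵒᵖ M →
      (∀ i : ℕ, Subsingleton (RightExt A M A i)) → Subsingleton M

/-- The Generalized Nakayama Conjecture (GNC). -/
def GeneralizedNakayama : Prop :=
  ∀ (A : Type u) [Ring A], IsNoetherianAlgebra A →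
    ∀ (M : Type u) [AddCommGroup M] [Module Aᵐᵒᵖ M], Module.Finite Aᵐᵒᵖ M → IsGenerator A M →
      (∀ i : ℕ, 0 < i → Subsingleton (RightExt A M M i)) → Module.Projective Aᵐᵒᵖ M

/-- The Idempotent Nakayama Conjecture (INC), for Wedderburn contexts. -/
def IdempotentNakayama : Prop :=
  ∀ (C : Type u) [Ring C], IsNoetherianAlgebra C →
    ∀ e : C, IsWedderburnContext e →
      (∀ i : ℕ, Subsingleton (RightExt C (MoritaDefect e) C i)) → Subsingleton (MoritaDefect e)

/-- The Idempotent Nakayama Conjecture for Wedderburn projectives (INC-prime). -/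
def IdempotentNakayamaPrime : Prop :=
  ∀ (B : Type u) [Ring B], IsNoetherianAlgebra B →
    ∀ (N : Type u) [AddCommGroup N] [Module Bᵐᵒᵖ N], IsWedderburnProjective B N →
      (∀ i : ℕ, Subsingleton (RightExt B (B ⧸ traceIdeal B N) B i)) → IsGenerator B N

end NakayamaConjectures

/-! (SNC) gives (INC') by taking the cyclic module `B ⧸ traceIdeal B N`. The rest is the cycle
(INC') ⇒ (INC) ⇒ (GNC) ⇒ (INC').

Both (GNC) steps rest on `IsTraceContext`: for a bimodule `M` with `C = End_A(M)`, `F = Hom_A(M, -)`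
sends injectives to injectives, and Hom_C(C/T, F Y) = 0 because M = TM. Dimension shifting along Y →
I → I/Y then gives `subsingleton_ext_iff`: Ext_C(C/T, C) vanishes in all degrees iff Ext_A(M, M)
vanishes in positive degrees. Also 1 ∈ T iff the finitely generated M is projective over A.

For (INC) ⇒ (GNC) this is applied to the A-module A × M, with T = CeC and e the projection onto A;
for (GNC) ⇒ (INC') to Hom_B(N, B) over End_B(N), with C = B and T the trace ideal. For (INC') ⇒
(INC) one takes N = eC. -/

namespace NakayamaConjectures

/-! ### Vanishing of Ext and lifting along short exact sequences. -/

section ModuleExt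

variable {R : Type u} [Ring R] {X Y Z Y₁ Y₂ Y₃ : Type u} [AddCommGroup X] [Module R X]
  [AddCommGroup Y] [Module R Y] [AddCommGroup Z] [Module R Z]
  [AddCommGroup Y₁] [Module R Y₁] [AddCommGroup Y₂] [Module R Y₂] [AddCommGroup Y₃] [Module R Y₃]

/-- The group `Ext^i_R(X, Y)` of left `R`-modules. -/
abbrev ModuleExt (R : Type u) [Ring R] (X Y : Type u) [AddCommGroup X] [Module R X]
    [AddCommGroup Y] [Module R Y] (i : ℕ) : Type u :=
  Abelian.Ext.{u} (ModuleCat.of R X) (ModuleCat.of R Y) i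

theorem subsingleton_ext_zero_iff :
    Subsingleton (ModuleExt R X Y 0) ↔ ∀ f : X →ₗ[R] Y, f = 0 := by
  rw [(Abelian.Ext.homEquiv₀.trans ModuleCat.homEquiv).subsingleton_congr]
  exact ⟨fun h f => Subsingleton.elim _ _, fun h => ⟨fun f g => (h f).trans (h g).symm⟩⟩

theorem subsingleton_ext_of_injective (hY : Module.Injective R Y) (i : ℕ) :
    Subsingleton (ModuleExt R X Y (i + 1)) :=
  have := Module.injective_object_of_injective_module R Y
  Abelian.Ext.subsingleton_of_injective _ _ _

/-- `Ext` vanishes on a module whose identity factors additively through another module on which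
it vanishes. -/
theorem subsingleton_ext_of_sum_eq_id {n : ℕ} (p : Fin n → X →ₗ[R] Y) (s : Fin n → Y →ₗ[R] X)
    (h : ∑ k, s k ∘ₗ p k = LinearMap.id) (i : ℕ) (hY : Subsingleton (ModuleExt R Y Y i)) :
    Subsingleton (ModuleExt R X X i) := by
  refine subsingleton_of_forall_eq 0 fun x => ?_
  have hid : ∑ k, ModuleCat.ofHom (p k) ≫ ModuleCat.ofHom (s k) = 𝟙 (ModuleCat.of R X) := by
    ext x
    simpa using LinearMap.congr_fun h x
  have h₁ : x = (Abelian.Ext.mk₀ (𝟙 (ModuleCat.of R X))).comp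
      (x.comp (Abelian.Ext.mk₀ (𝟙 (ModuleCat.of R X))) (add_zero i)) (zero_add i) := by simp
  -- Expanding both identities turns x into a double sum whose terms all pass through a class in
  -- Ext^i(Y, Y).
  rw [h₁, ← hid, Abelian.Ext.mk₀_sum, Abelian.Ext.comp_sum, Abelian.Ext.sum_comp]
  refine Finset.sum_eq_zero fun k _ => ?_
  rw [Abelian.Ext.comp_sum]
  refine Finset.sum_eq_zero fun l _ => ?_
  rw [← Abelian.Ext.mk₀_comp_mk₀, ← Abelian.Ext.mk₀_comp_mk₀,
    Abelian.Ext.comp_assoc_of_second_deg_zero,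
    ← Abelian.Ext.comp_assoc_of_third_deg_zero, ← Abelian.Ext.comp_assoc_of_third_deg_zero,
    ← Abelian.Ext.comp_assoc_of_third_deg_zero,
    Abelian.Ext.comp_assoc_of_third_deg_zero _ _ (Abelian.Ext.mk₀ (ModuleCat.ofHom (p l))),
    Subsingleton.elim ((((Abelian.Ext.mk₀ (ModuleCat.ofHom (s k))).comp x _).comp
      (Abelian.Ext.mk₀ (ModuleCat.ofHom (p l))) _)) 0]
  simp

theorem subsingleton_ext_congr (e : Y ≃ₗ[R] Z) (i : ℕ) :
    Subsingleton (ModuleExt R X Y i) ↔ Subsingleton (ModuleExt R X Z i) :=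
  ((Abelian.extFunctorObj (ModuleCat.of R X) i).mapIso
    e.toModuleIso).addCommGroupIsoToAddEquiv.toEquiv.subsingleton_congr

variable {f : Y₁ →ₗ[R] Y₂} {g : Y₂ →ₗ[R] Y₃}

theorem shortExact_of_exact (hf : Function.Injective f) (hfg : Function.Exact f g)
    (hg : Function.Surjective g) :
    (ShortComplex.mk (ModuleCat.ofHom f) (ModuleCat.ofHom g)
      (by ext x; exact hfg.apply_apply_eq_zero x)).ShortExact :=
  { exact := (ShortComplex.ShortExact.moduleCat_exact_iff_function_exact _).2 hfg
    mono_f := (ModuleCat.mono_iff_injective _).2 hf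
    epi_g := (ModuleCat.epi_iff_surjective _).2 hg }

theorem subsingleton_ext_left (hf : Function.Injective f) (hfg : Function.Exact f g)
    (hg : Function.Surjective g) {i : ℕ} (h₃ : Subsingleton (ModuleExt R X Y₃ i))
    (h₂ : Subsingleton (ModuleExt R X Y₂ (i + 1))) :
    Subsingleton (ModuleExt R X Y₁ (i + 1)) := by
  refine subsingleton_of_forall_eq 0 fun x => ?_
  obtain ⟨y, rfl⟩ := Abelian.Ext.covariant_sequence_exact₁ _ (shortExact_of_exact hf hfg hg) x
    (h₂.elim _ _) rfl
  rw [h₃.elim y 0, Abelian.Ext.zero_comp]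

theorem subsingleton_ext_right (hf : Function.Injective f) (hfg : Function.Exact f g)
    (hg : Function.Surjective g) {i : ℕ} (h₂ : Subsingleton (ModuleExt R X Y₂ i))
    (h₁ : Subsingleton (ModuleExt R X Y₁ (i + 1))) :
    Subsingleton (ModuleExt R X Y₃ i) := by
  refine subsingleton_of_forall_eq 0 fun x => ?_
  obtain ⟨y, rfl⟩ := Abelian.Ext.covariant_sequence_exact₃ _ (shortExact_of_exact hf hfg hg) x
    rfl (h₁.elim _ _)
  rw [h₂.elim y 0, Abelian.Ext.zero_comp]

theorem exists_lift_of_subsingleton_ext (hf : Function.Injective f) (hfg : Function.Exact f g)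
    (hg : Function.Surjective g) (h₁ : Subsingleton (ModuleExt R X Y₁ 1)) (q : X →ₗ[R] Y₃) :
    ∃ r : X →ₗ[R] Y₂, g ∘ₗ r = q := by
  obtain ⟨y, hy⟩ := Abelian.Ext.covariant_sequence_exact₃ _ (shortExact_of_exact hf hfg hg)
    (Abelian.Ext.mk₀ (ModuleCat.ofHom q)) (n₁ := 1) rfl (h₁.elim _ _)
  obtain ⟨r, rfl⟩ := (Abelian.Ext.mk₀_bijective _ _).2 y
  rw [Abelian.Ext.mk₀_comp_mk₀] at hy
  exact ⟨r.hom, congrArg ModuleCat.Hom.hom ((Abelian.Ext.mk₀_bijective _ _).1 hy)⟩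

/-- As Y₂ is injective, every class is the pullback of the extension class along some q; a q that
lifts to Y₂ pulls it back to zero. -/
theorem subsingleton_ext_one_of_exists_lift (hf : Function.Injective f)
    (hfg : Function.Exact f g) (hg : Function.Surjective g) (hY₂ : Module.Injective R Y₂)
    (h : ∀ q : X →ₗ[R] Y₃, ∃ r : X →ₗ[R] Y₂, g ∘ₗ r = q) :
    Subsingleton (ModuleExt R X Y₁ 1) := by
  refine subsingleton_of_forall_eq 0 fun x => ?_
  have hS := shortExact_of_exact hf hfg hg
  obtain ⟨y, rfl⟩ := Abelian.Ext.covariant_sequence_exact₁ _ hS x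
    ((subsingleton_ext_of_injective hY₂ 0).elim _ _) rfl
  obtain ⟨q, rfl⟩ := (Abelian.Ext.mk₀_bijective _ _).2 y
  obtain ⟨r, hr⟩ := h q.hom
  have hq : q = ModuleCat.ofHom r ≫ ModuleCat.ofHom g := by
    ext x
    exact (LinearMap.congr_fun hr x).symm
  rw [hq, ← Abelian.Ext.mk₀_comp_mk₀, Abelian.Ext.comp_assoc_of_second_deg_zero]
  erw [hS.comp_extClass]
  simp

theorem exists_extension_of_subsingleton_ext (hf : Function.Injective f)
    (hfg : Function.Exact f g) (hg : Function.Surjective g)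
    (h₁ : Subsingleton (ModuleExt R Y₃ X 1)) (q : Y₁ →ₗ[R] X) :
    ∃ r : Y₂ →ₗ[R] X, r ∘ₗ f = q := by
  obtain ⟨y, hy⟩ := Abelian.Ext.contravariant_sequence_exact₁ (shortExact_of_exact hf hfg hg) _
    (Abelian.Ext.mk₀ (ModuleCat.ofHom q)) (n₁ := 1) rfl (h₁.elim _ _)
  obtain ⟨r, rfl⟩ := (Abelian.Ext.mk₀_bijective _ _).2 y
  rw [Abelian.Ext.mk₀_comp_mk₀] at hy
  exact ⟨r.hom, congrArg ModuleCat.Hom.hom ((Abelian.Ext.mk₀_bijective _ _).1 hy)⟩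

theorem exists_injective_embedding (R : Type u) [Ring R] (Y : Type u) [AddCommGroup Y]
    [Module R Y] : ∃ (I : ModuleCat.{u} R) (f : Y →ₗ[R] I),
      Module.Injective R I ∧ Function.Injective f :=
  ⟨Injective.under (ModuleCat.of R Y), (Injective.ι (ModuleCat.of R Y)).hom,
    @Module.injective_module_of_injective_object R _ _ _ _
      (inferInstanceAs (Injective (Injective.under (ModuleCat.of R Y)))),
    (ModuleCat.mono_iff_injective _).1 inferInstance⟩

end ModuleExt

/-! ### The functor Hom_A(M, -) to right C-modules. -/

/-- The map `C → E`, `c ↦ e c` defined by an element `e` of a right `C`-module `E`. -/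
def toRightModule {C E : Type u} [Ring C] [AddCommGroup E] [Module Cᵐᵒᵖ E] (e : E) :
    C →ₗ[Cᵐᵒᵖ] E where
  toFun c := MulOpposite.op c • e
  map_add' c d := by rw [MulOpposite.op_add, add_smul]
  map_smul' c d := by
    rw [MulOpposite.smul_eq_mul_unop, MulOpposite.op_mul, mul_smul]
    rfl

@[simp]
theorem toRightModule_apply {C E : Type u} [Ring C] [AddCommGroup E] [Module Cᵐᵒᵖ E] (e : E)
    (c : C) : toRightModule e c = MulOpposite.op c • e := rfl

/-- For a `C`-`A`-bimodule `M` and a right `A`-module `Y`, the abelian group `Hom_A(M, Y)`, which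
is a right `C`-module by precomposition. -/
def BimoduleHom (A M Y : Type u) [Ring A] [AddCommGroup M] [Module Aᵐᵒᵖ M] [AddCommGroup Y]
    [Module Aᵐᵒᵖ Y] : Type u :=
  M →ₗ[Aᵐᵒᵖ] Y

namespace BimoduleHom

variable {A C M Y Y' : Type u} [Ring A] [Ring C] [AddCommGroup M] [Module C M] [Module Aᵐᵒᵖ M]
  [SMulCommClass C Aᵐᵒᵖ M] [AddCommGroup Y] [Module Aᵐᵒᵖ Y] [AddCommGroup Y'] [Module Aᵐᵒᵖ Y']

instance : AddCommGroup (BimoduleHom A M Y) :=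
  inferInstanceAs (AddCommGroup (M →ₗ[Aᵐᵒᵖ] Y))

instance : FunLike (BimoduleHom A M Y) M Y :=
  inferInstanceAs (FunLike (M →ₗ[Aᵐᵒᵖ] Y) M Y)

instance : LinearMapClass (BimoduleHom A M Y) Aᵐᵒᵖ M Y :=
  inferInstanceAs (LinearMapClass (M →ₗ[Aᵐᵒᵖ] Y) Aᵐᵒᵖ M Y)

@[ext]
theorem ext {f g : BimoduleHom A M Y} (h : ∀ x, f x = g x) : f = g :=
  LinearMap.ext h

@[simp]
theorem add_apply (f g : BimoduleHom A M Y) (x : M) : (f + g) x = f x + g x := rfl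

@[simp]
theorem zero_apply (x : M) : (0 : BimoduleHom A M Y) x = 0 := rfl

@[simp]
theorem sum_apply {ι : Type*} (s : Finset ι) (f : ι → BimoduleHom A M Y) (x : M) :
    (∑ i ∈ s, f i) x = ∑ i ∈ s, f i x :=
  LinearMap.sum_apply s f x

instance : SMul Cᵐᵒᵖ (BimoduleHom A M Y) where
  smul c f :=
    ({ toFun := fun x => f (c.unop • x)
       map_add' := fun x y => by rw [smul_add, map_add]
       map_smul' := fun a x => by rw [smul_comm, map_smul, RingHom.id_apply] } : M →ₗ[Aᵐᵒᵖ] Y)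

@[simp]
theorem smul_apply (c : Cᵐᵒᵖ) (f : BimoduleHom A M Y) (x : M) : (c • f) x = f (c.unop • x) := rfl

instance : Module Cᵐᵒᵖ (BimoduleHom A M Y) where
  one_smul f := by ext x; simp
  mul_smul c d f := by ext x; simp [mul_smul]
  smul_zero c := by ext x; simp
  smul_add c f g := by ext x; simp
  add_smul c d f := by ext x; simp [add_smul]
  zero_smul f := by ext x; simp

variable (C M) in
/-- Postcomposition with an `A`-linear map, as a map of right `C`-modules. -/
def map (q : Y →ₗ[Aᵐᵒᵖ] Y') : BimoduleHom A M Y →ₗ[Cᵐᵒᵖ] BimoduleHom A M Y' where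
  toFun f := q ∘ₗ (show M →ₗ[Aᵐᵒᵖ] Y from f)
  map_add' f g := by ext x; exact map_add q _ _
  map_smul' c f := rfl

theorem map_injective {q : Y →ₗ[Aᵐᵒᵖ] Y'} (hq : Function.Injective q) :
    Function.Injective (map C M q) :=
  fun _ _ h => ext fun x => hq (DFunLike.congr_fun h x)

theorem map_exact {Y'' : Type u} [AddCommGroup Y''] [Module Aᵐᵒᵖ Y''] {p : Y →ₗ[Aᵐᵒᵖ] Y'}
    {q : Y' →ₗ[Aᵐᵒᵖ] Y''} (hp : Function.Injective p) (hpq : Function.Exact p q) :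
    Function.Exact (map C M p) (map C M q) := by
  intro f
  constructor
  · intro hf
    have h (x : M) : f x ∈ LinearMap.range p := (hpq _).1 (DFunLike.congr_fun hf x)
    refine ⟨(LinearEquiv.ofInjective p hp).symm.toLinearMap ∘ₗ
      LinearMap.codRestrict _ (show M →ₗ[Aᵐᵒᵖ] Y' from f) h, ext fun x => ?_⟩
    exact congrArg Subtype.val ((LinearEquiv.ofInjective p hp).apply_symm_apply ⟨f x, h x⟩)
  · rintro ⟨g, rfl⟩
    ext x
    exact hpq.apply_apply_eq_zero (g x)

end BimoduleHom

/-! ### Trace contexts: comparing Ext over C with Ext over A. -/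

/-- A `C`-`A`-bimodule `M` with `C = End_A(M)` which is finitely generated projective over `C`,
together with a right ideal `T` of `C` which contains the trace ideal of `M` and acts on `M` by
maps along which `A`-linear maps out of `M` become liftable. -/
structure IsTraceContext (A : Type u) {C : Type u} (M : Type u) [Ring A] [Ring C] [AddCommGroup M]
    [Module C M] [Module Aᵐᵒᵖ M] [SMulCommClass C Aᵐᵒᵖ M] (T : Submodule Cᵐᵒᵖ C) : Prop where
  dual_basis : ∃ (n : ℕ) (m : Fin n → M) (φ : Fin n → M →ₗ[C] C),
    (∀ x, ∑ i, φ i x • m i = x) ∧ ∀ i x, φ i x ∈ T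
  lifts : ∀ t ∈ T, ∀ (Y₁ Y₂ : Type u) [AddCommGroup Y₁] [Module Aᵐᵒᵖ Y₁] [AddCommGroup Y₂]
    [Module Aᵐᵒᵖ Y₂] (p : Y₁ →ₗ[Aᵐᵒᵖ] Y₂), Function.Surjective p → ∀ f : M →ₗ[Aᵐᵒᵖ] Y₂,
    ∃ g : M →ₗ[Aᵐᵒᵖ] Y₁, ∀ x, p (g x) = f (t • x)
  faithful : ∀ c : C, (∀ x : M, c • x = 0) → c = 0
  full : ∀ f : M →ₗ[Aᵐᵒᵖ] M, ∃ c : C, ∀ x, f x = c • x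

namespace IsTraceContext

variable {A C M : Type u} [Ring A] [Ring C] [AddCommGroup M] [Module C M] [Module Aᵐᵒᵖ M]
  [SMulCommClass C Aᵐᵒᵖ M] {T : Submodule Cᵐᵒᵖ C}

/-- Hom_A(M, -) is right adjoint to - ⊗_C M, which is exact as M is projective over C. Baer's
criterion makes this explicit without tensor products. -/
theorem injective_bimoduleHom (h : IsTraceContext A M T) {I : Type u} [AddCommGroup I]
    [Module Aᵐᵒᵖ I] (hI : Module.Injective Aᵐᵒᵖ I) :
    Module.Injective Cᵐᵒᵖ (BimoduleHom A M I) := by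
  obtain ⟨n, m, φ, hφ, -⟩ := h.dual_basis
  refine Module.Baer.injective fun J g => ?_
  have hexp (i : Fin n) (x : M) (a : Aᵐᵒᵖ) : MulOpposite.op (φ i (a • x)) =
      ∑ k, MulOpposite.op (φ i (a • m k)) * MulOpposite.op (φ k x) := by
    conv_lhs => rw [← hφ x]
    simp [Finset.smul_sum, ← smul_comm _ a]
  -- This is JM, the image of J ⊗_C M in M.
  let P : Submodule Aᵐᵒᵖ M :=
    { carrier := {x | ∀ i, MulOpposite.op (φ i x) ∈ J}
      add_mem' := fun hx hy i => by
        rw [map_add, MulOpposite.op_add]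
        exact J.add_mem (hx i) (hy i)
      zero_mem' := fun i => by simp
      smul_mem' := fun a x hx i => by
        rw [hexp]
        exact J.sum_mem fun k _ => J.mul_mem_left _ (hx k) }
  -- The adjoint of g, sending jm to g(j)(m). Its extension to M is the element of Hom_A(M, I) that
  -- Baer's criterion requires.
  let h₀ : P →ₗ[Aᵐᵒᵖ] I :=
    { toFun := fun x => ∑ i, g ⟨MulOpposite.op (φ i x), x.2 i⟩ (m i)
      map_add' := fun x y => by
        rw [← Finset.sum_add_distrib]
        refine Finset.sum_congr rfl fun i _ => ?_
        rw [← BimoduleHom.add_apply, ← map_add]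
        congr 2
        ext
        simp
      map_smul' := fun a x => by
        have key (i : Fin n) : g ⟨MulOpposite.op (φ i (a • x : P)), (a • x).2 i⟩ =
            ∑ k, MulOpposite.op (φ i (a • m k)) • g ⟨MulOpposite.op (φ k x), x.2 k⟩ := by
          simp_rw [← map_smul]
          rw [← map_sum]
          congr 1
          ext1
          rw [AddSubmonoidClass.coe_finsetSum]
          exact hexp i x a
        simp_rw [key, BimoduleHom.sum_apply, RingHom.id_apply]
        rw [Finset.sum_comm, Finset.smul_sum]
        refine Finset.sum_congr rfl fun k _ => ?_
        simp_rw [BimoduleHom.smul_apply, MulOpposite.unop_op]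
        rw [← map_sum, hφ, map_smul] }
  obtain ⟨h₁, hh₁⟩ := hI.out P.subtype P.injective_subtype h₀
  refine ⟨LinearMap.toSpanSingleton Cᵐᵒᵖ (BimoduleHom A M I) h₁, fun c hc => ?_⟩
  ext x
  have hop (i : Fin n) : MulOpposite.op (φ i (c.unop • x)) = MulOpposite.op (φ i x) * c := by
    simp
  have hmem : c.unop • x ∈ P := fun i => by
    rw [hop]
    exact J.mul_mem_left _ hc
  have hterm (i : Fin n) : g ⟨MulOpposite.op (φ i (c.unop • x)), hmem i⟩ =
      MulOpposite.op (φ i x) • g ⟨c, hc⟩ := by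
    rw [← map_smul]
    congr 1
    ext1
    exact hop i
  calc h₁ (c.unop • x) = h₀ ⟨c.unop • x, hmem⟩ := hh₁ ⟨_, hmem⟩
    _ = ∑ i, g ⟨MulOpposite.op (φ i (c.unop • x)), hmem i⟩ (m i) := rfl
    _ = g ⟨c, hc⟩ x := by
      simp_rw [hterm, BimoduleHom.smul_apply, MulOpposite.unop_op]
      rw [← map_sum, hφ]

/-- By adjunction this is (C/T) ⊗_C M = M/TM = 0: the dual basis has coefficients in T. -/
theorem quotient_hom_eq_zero (h : IsTraceContext A M T) {Y : Type u} [AddCommGroup Y]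
    [Module Aᵐᵒᵖ Y] (f : (C ⧸ T) →ₗ[Cᵐᵒᵖ] BimoduleHom A M Y) : f = 0 := by
  obtain ⟨n, m, φ, hφ, hT⟩ := h.dual_basis
  have hsmul (c : C) : f (T.mkQ c) = MulOpposite.op c • f (T.mkQ 1) := by
    rw [← map_smul, ← map_smul, op_smul_eq_mul, one_mul]
  have h1 : f (T.mkQ 1) = 0 := by
    ext x
    rw [← hφ x, map_sum]
    refine Finset.sum_eq_zero fun i _ => ?_
    have := hsmul (φ i x)
    rw [Submodule.mkQ_apply, (Submodule.Quotient.mk_eq_zero T).2 (hT i x), map_zero] at this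
    exact (DFunLike.congr_fun this (m i)).symm
  ext c
  rw [LinearMap.comp_apply, hsmul, h1, smul_zero]
  rfl

theorem subsingleton_ext_injective (h : IsTraceContext A M T) {I : Type u} [AddCommGroup I]
    [Module Aᵐᵒᵖ I] (hI : Module.Injective Aᵐᵒᵖ I) (i : ℕ) :
    Subsingleton (RightExt C (C ⧸ T) (BimoduleHom A M I) i) :=
  match i with
  | 0 => subsingleton_ext_zero_iff.2 h.quotient_hom_eq_zero
  | i + 1 => subsingleton_ext_of_injective (h.injective_bimoduleHom hI) i

theorem subsingleton_ext_quotient (h : IsTraceContext A M T) (i : ℕ) (Y : Type u)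
    [AddCommGroup Y] [Module Aᵐᵒᵖ Y] (hY : ∀ j, Subsingleton (RightExt A M Y (j + 1))) :
    Subsingleton (RightExt C (C ⧸ T) (BimoduleHom A M Y) i) := by
  induction i generalizing Y with
  | zero => exact subsingleton_ext_zero_iff.2 h.quotient_hom_eq_zero
  | succ i ih =>
    obtain ⟨I, f, hI, hf⟩ := exists_injective_embedding Aᵐᵒᵖ Y
    have hfg := LinearMap.exact_map_mkQ_range f
    have hg := (LinearMap.range f).mkQ_surjective
    have hG : Function.Surjective (BimoduleHom.map C M (LinearMap.range f).mkQ) :=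
      exists_lift_of_subsingleton_ext hf hfg hg (hY 0)
    refine subsingleton_ext_left (BimoduleHom.map_injective hf) (BimoduleHom.map_exact hf hfg) hG
      (ih _ fun j => ?_) (h.subsingleton_ext_injective hI _)
    exact subsingleton_ext_right hf hfg hg (subsingleton_ext_of_injective hI _) (hY (j + 1))

/-- The cokernel E of `BimoduleHom.map C M g` is Ext^1_A(M, Y₁). It is killed by T, so it vanishes
once Hom_C(C/T, E) = 0, which two dimension shifts deduce from the vanishing of Ext^2. -/
theorem exists_lift (h : IsTraceContext A M T) {Y₁ Y₂ Y₃ : Type u} [AddCommGroup Y₁]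
    [Module Aᵐᵒᵖ Y₁] [AddCommGroup Y₂] [Module Aᵐᵒᵖ Y₂] [AddCommGroup Y₃] [Module Aᵐᵒᵖ Y₃]
    {f : Y₁ →ₗ[Aᵐᵒᵖ] Y₂} {g : Y₂ →ₗ[Aᵐᵒᵖ] Y₃} (hf : Function.Injective f)
    (hfg : Function.Exact f g) (hg : Function.Surjective g) (hY₂ : Module.Injective Aᵐᵒᵖ Y₂)
    (h₁ : Subsingleton (RightExt C (C ⧸ T) (BimoduleHom A M Y₁) 2)) :
    Function.Surjective (BimoduleHom.map C M g) := by
  set G := BimoduleHom.map C M g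
  have hZ : Subsingleton (RightExt C (C ⧸ T) (LinearMap.range G) 1) :=
    subsingleton_ext_right (BimoduleHom.map_injective hf)
      (g := G.rangeRestrict) (fun x => by
        rw [← BimoduleHom.map_exact (C := C) (M := M) hf hfg x, ← Subtype.coe_inj]; rfl)
      G.surjective_rangeRestrict (h.subsingleton_ext_injective hY₂ 1) h₁
  have hE : Subsingleton (RightExt C (C ⧸ T) (BimoduleHom A M Y₃ ⧸ LinearMap.range G) 0) :=
    subsingleton_ext_right (LinearMap.range G).injective_subtype
      (LinearMap.exact_subtype_mkQ _) (LinearMap.range G).mkQ_surjective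
      (subsingleton_ext_zero_iff.2 h.quotient_hom_eq_zero) hZ
  intro q
  -- T kills the class of q in E, so 1 ↦ [q] defines a map C/T → E, which must be zero.
  have hT : T ≤ LinearMap.ker (toRightModule ((LinearMap.range G).mkQ q)) := fun t ht => by
    obtain ⟨r, hr⟩ := h.lifts t ht Y₂ Y₃ g hg q
    rw [LinearMap.mem_ker, toRightModule_apply, ← map_smul, Submodule.mkQ_apply,
      Submodule.Quotient.mk_eq_zero]
    exact ⟨r, BimoduleHom.ext hr⟩
  have h0 := LinearMap.congr_fun (subsingleton_ext_zero_iff.1 hE (T.liftQ _ hT)) (T.mkQ 1)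
  exact (Submodule.Quotient.mk_eq_zero _).1 ((one_smul Cᵐᵒᵖ ((LinearMap.range G).mkQ q)).symm.trans h0)

theorem subsingleton_ext_bimodule (h : IsTraceContext A M T) (i : ℕ) (Y : Type u)
    [AddCommGroup Y] [Module Aᵐᵒᵖ Y]
    (hY : ∀ j, Subsingleton (RightExt C (C ⧸ T) (BimoduleHom A M Y) j)) :
    Subsingleton (RightExt A M Y (i + 1)) := by
  induction i generalizing Y with
  | zero =>
    obtain ⟨I, f, hI, hf⟩ := exists_injective_embedding Aᵐᵒᵖ Y
    have hfg := LinearMap.exact_map_mkQ_range f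
    have hg := (LinearMap.range f).mkQ_surjective
    exact subsingleton_ext_one_of_exists_lift hf hfg hg hI (h.exists_lift hf hfg hg hI (hY 2))
  | succ i ih =>
    obtain ⟨I, f, hI, hf⟩ := exists_injective_embedding Aᵐᵒᵖ Y
    have hfg := LinearMap.exact_map_mkQ_range f
    have hg := (LinearMap.range f).mkQ_surjective
    refine subsingleton_ext_left hf hfg hg (ih _ fun j => ?_) (subsingleton_ext_of_injective hI _)
    exact subsingleton_ext_right (BimoduleHom.map_injective hf) (BimoduleHom.map_exact hf hfg)
      (h.exists_lift hf hfg hg hI (hY 2)) (h.subsingleton_ext_injective hI j) (hY (j + 1))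

/-- The right `C`-modules `C` and `End_A(M)` are isomorphic. -/
noncomputable def equivBimoduleHom (h : IsTraceContext A M T) : C ≃ₗ[Cᵐᵒᵖ] BimoduleHom A M M :=
  LinearEquiv.ofBijective (toRightModule (LinearMap.id : M →ₗ[Aᵐᵒᵖ] M) :
      C →ₗ[Cᵐᵒᵖ] BimoduleHom A M M)
    ⟨(injective_iff_map_eq_zero _).2 fun c hc => h.faithful c (DFunLike.congr_fun hc),
      fun f => (h.full f).imp fun _ hc => BimoduleHom.ext fun x => (hc x).symm⟩

theorem subsingleton_ext_iff (h : IsTraceContext A M T) :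
    (∀ i, Subsingleton (RightExt C (C ⧸ T) C i)) ↔
      ∀ i, 0 < i → Subsingleton (RightExt A M M i) := by
  simp_rw [subsingleton_ext_congr h.equivBimoduleHom]
  refine ⟨fun hC i hi => ?_, fun hM i => h.subsingleton_ext_quotient i M fun j => hM _ j.succ_pos⟩
  obtain ⟨j, rfl⟩ := Nat.exists_eq_succ_of_ne_zero hi.ne'
  exact h.subsingleton_ext_bimodule j M hC

theorem projective_of_one_mem (h : IsTraceContext A M T) (h1 : (1 : C) ∈ T) :
    Module.Projective Aᵐᵒᵖ M := by
  obtain ⟨g, hg⟩ := h.lifts 1 h1 (M →₀ Aᵐᵒᵖ) M (Finsupp.linearCombination Aᵐᵒᵖ id)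
    (Finsupp.linearCombination_surjective _ Function.surjective_id) LinearMap.id
  exact Module.Projective.of_split g (Finsupp.linearCombination Aᵐᵒᵖ id)
    (LinearMap.ext fun x => by simpa using hg x)

/-- Combining the dual bases over A and C gives x = ∑ φᵢ(pⱼ) (sⱼ(x) mᵢ), where pⱼ are the generators
and sⱼ the coordinates over A. Each x ↦ sⱼ(x) mᵢ is A-linear, hence some cᵢⱼ in C, and so 1 = ∑
φᵢ(pⱼ) cᵢⱼ lies in T. -/
theorem one_mem_of_projective (h : IsTraceContext A M T) (hfin : Module.Finite Aᵐᵒᵖ M)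
    (hproj : Module.Projective Aᵐᵒᵖ M) : (1 : C) ∈ T := by
  obtain ⟨n, m, φ, hφ, hT⟩ := h.dual_basis
  obtain ⟨k, p, hp⟩ := Module.Finite.exists_fin' Aᵐᵒᵖ M
  obtain ⟨s, hs⟩ := Module.projective_lifting_property p LinearMap.id hp
  have hc (i : Fin n) (j : Fin k) : ∃ c : C, ∀ x, s x j • m i = c • x :=
    h.full (LinearMap.toSpanSingleton Aᵐᵒᵖ M (m i) ∘ₗ
      (LinearMap.proj j : (Fin k → Aᵐᵒᵖ) →ₗ[Aᵐᵒᵖ] Aᵐᵒᵖ) ∘ₗ s)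
  choose c hc using hc
  have h1 : (1 : C) = ∑ j, ∑ i, φ i (p (Pi.single j 1)) * c i j := by
    rw [← sub_eq_zero]
    refine h.faithful _ fun x => ?_
    have hx : ∑ j, s x j • p (Pi.single j 1) = x := by
      simp_rw [← map_smul]
      rw [← map_sum]
      refine Eq.trans (congrArg p ?_) (LinearMap.congr_fun hs x)
      ext j
      simp [Finset.sum_apply, Pi.single_apply]
    rw [sub_smul, one_smul, sub_eq_zero]
    conv_lhs => rw [← hx]
    simp_rw [Finset.sum_smul, mul_smul, ← hc]
    refine Finset.sum_congr rfl fun j _ => ?_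
    simp_rw [smul_comm (φ _ _) (s x j), ← Finset.smul_sum]
    rw [hφ]
  rw [h1]
  exact T.sum_mem fun j _ => T.sum_mem fun i _ => T.smul_mem (MulOpposite.op (c i j)) (hT i _)

end IsTraceContext

/-! ### Generators and trace ideals. -/

section Generator

variable {A X : Type u} [Ring A] [AddCommGroup X] [Module Aᵐᵒᵖ X]

theorem isGenerator_iff_exists_sum : IsGenerator A X ↔
    ∃ (n : ℕ) (f : Fin n → X →ₗ[Aᵐᵒᵖ] A) (x : Fin n → X), ∑ i, f i (x i) = 1 := by
  constructor
  · rintro ⟨n, F, hF⟩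
    obtain ⟨x, hx⟩ := hF 1
    refine ⟨n, fun i => F ∘ₗ LinearMap.single Aᵐᵒᵖ (fun _ => X) i, x, ?_⟩
    simp_rw [LinearMap.comp_apply, LinearMap.single_apply]
    rw [← map_sum, Finset.univ_sum_single, hx]
  · rintro ⟨n, f, x, hx⟩
    refine ⟨n, ∑ i, f i ∘ₗ LinearMap.proj i, fun a => ⟨MulOpposite.op a • x, ?_⟩⟩
    simp [hx]

theorem apply_mem_traceIdeal (f : X →ₗ[Aᵐᵒᵖ] A) (x : X) : f x ∈ traceIdeal A X :=
  Submodule.mem_iSup_of_mem f (LinearMap.mem_range_self f x)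

theorem isGenerator_iff_one_mem_traceIdeal : IsGenerator A X ↔ (1 : A) ∈ traceIdeal A X := by
  rw [isGenerator_iff_exists_sum]
  constructor
  · rintro ⟨n, f, x, hx⟩
    rw [← hx]
    exact Submodule.sum_mem _ fun i _ => apply_mem_traceIdeal (f i) (x i)
  · intro h
    obtain ⟨v, hv, h1⟩ := (Submodule.mem_iSup_iff_exists_finsupp _ _).1 h
    choose x hx using hv
    let e := v.support.equivFin
    refine ⟨_, fun i => (e.symm i : X →ₗ[Aᵐᵒᵖ] A), fun i => x (e.symm i), ?_⟩
    simp_rw [hx]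
    rw [Equiv.sum_comp e.symm (fun g : v.support => v g), Finset.sum_coe_sort, ← h1]
    rfl

theorem subsingleton_quotient_iff_one_mem {T : Submodule Aᵐᵒᵖ A} :
    Subsingleton (A ⧸ T) ↔ (1 : A) ∈ T := by
  rw [Submodule.Quotient.subsingleton_iff, Submodule.eq_top_iff']
  refine ⟨fun h => h 1, fun h a => ?_⟩
  simpa using T.smul_mem (MulOpposite.op a) h

end Generator

theorem finite_self (A : Type u) [Ring A] : Module.Finite Aᵐᵒᵖ A :=
  Module.Finite.of_surjective (LinearMap.toSpanSingleton Aᵐᵒᵖ A 1)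
    fun a => ⟨MulOpposite.op a, by simp⟩

theorem idempotentNakayamaPrime_of_strongNakayama (h : StrongNakayama.{u}) :
    IdempotentNakayamaPrime.{u} := fun B _ hB N _ _ _ hExt =>
  have := finite_self B
  isGenerator_iff_one_mem_traceIdeal.2 <|
    subsingleton_quotient_iff_one_mem.1 <| h B hB (B ⧸ traceIdeal B N) inferInstance hExt

/-! ### The Wedderburn projective eC. -/

section Corner

variable {C : Type u} [Ring C] {e : C}

/-- The right ideal `eC = {x | e x = x}` defined by an idempotent `e`. -/
def cornerIdeal (e : C) : Submodule Cᵐᵒᵖ C where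
  carrier := {x | e * x = x}
  add_mem' {x y} hx hy := by
    change e * (x + y) = x + y
    rw [mul_add, show e * x = x from hx, show e * y = y from hy]
  zero_mem' := mul_zero e
  smul_mem' c x hx := by
    change e * c • x = c • x
    rw [MulOpposite.smul_eq_mul_unop, ← mul_assoc, show e * x = x from hx]

/-- Left multiplication by `a`, as a map `eC → C`. -/
def cornerMulLeft (e a : C) : cornerIdeal e →ₗ[Cᵐᵒᵖ] C where
  toFun x := a * x
  map_add' _ _ := mul_add a _ _
  map_smul' _ _ := (mul_assoc a _ _).symm

@[simp]
theorem cornerMulLeft_apply (a : C) (x : cornerIdeal e) : cornerMulLeft e a x = a * x := rfl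

theorem mul_mem_cornerIdeal (he : IsIdempotentElem e) (a : C) : e * a ∈ cornerIdeal e := by
  change e * (e * a) = e * a
  rw [← mul_assoc, he.eq]

theorem self_mem_cornerIdeal (he : IsIdempotentElem e) : e ∈ cornerIdeal e := he

theorem mul_mul_mem_idealOf (a b : C) : a * e * b ∈ idealOf e :=
  Submodule.subset_span ⟨a, b, rfl⟩

theorem apply_eq_apply_self_mul (he : IsIdempotentElem e) (f : cornerIdeal e →ₗ[Cᵐᵒᵖ] C)
    (x : cornerIdeal e) : f x = f ⟨e, self_mem_cornerIdeal he⟩ * x := by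
  rw [← op_smul_eq_mul, ← map_smul]
  congr 1
  ext
  exact x.2.symm

theorem traceIdeal_cornerIdeal (he : IsIdempotentElem e) :
    traceIdeal C (cornerIdeal e) = idealOf e := by
  refine le_antisymm (iSup_le ?_) (Submodule.span_le.2 ?_)
  · rintro f _ ⟨x, rfl⟩
    rw [apply_eq_apply_self_mul he, ← show e * x.1 = x from x.2, ← mul_assoc]
    exact mul_mul_mem_idealOf _ _
  · rintro _ ⟨a, b, rfl⟩
    rw [mul_assoc]
    exact apply_mem_traceIdeal (cornerMulLeft e a) ⟨e * b, mul_mem_cornerIdeal he b⟩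

/-- Such a y defines a map C/CeC → C with 1 ↦ y. -/
theorem eq_zero_of_mul_idealOf_eq_zero
    (h : Subsingleton (RightExt C (MoritaDefect e) C 0)) {y : C}
    (hy : ∀ a, y * (a * e) = 0) : y = 0 := by
  have hT : idealOf e ≤ LinearMap.ker (toRightModule y) := by
    refine Submodule.span_le.2 ?_
    rintro _ ⟨a, b, rfl⟩
    change y * (a * e * b) = 0
    rw [← mul_assoc, hy, zero_mul]
  have := LinearMap.congr_fun (subsingleton_ext_zero_iff.1 h ((idealOf e).liftQ _ hT))
    ((idealOf e).mkQ 1)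
  exact (mul_one y).symm.trans this

theorem doubleCentralizerMap_cornerIdeal_injective (he : IsIdempotentElem e)
    (h₀ : Subsingleton (RightExt C (MoritaDefect e) C 0)) :
    Function.Injective (doubleCentralizerMap C (cornerIdeal e)) := by
  refine (injective_iff_map_eq_zero _).2 fun r hr => ?_
  refine eq_zero_of_mul_idealOf_eq_zero h₀ fun a => ?_
  exact LinearMap.congr_fun (LinearMap.congr_fun hr (cornerMulLeft e a))
    ⟨e, self_mem_cornerIdeal he⟩

/-- Identify Hom_C(eC, C) with Ce. An eCe-linear φ induces a right C-linear map CeC → C, aeb ↦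
φ(ae)b, which extends to C since Ext^1 vanishes; the extension is left multiplication by the
required r. -/
theorem doubleCentralizerMap_cornerIdeal_surjective (he : IsIdempotentElem e)
    (h₀ : Subsingleton (RightExt C (MoritaDefect e) C 0))
    (h₁ : Subsingleton (RightExt C (MoritaDefect e) C 1)) :
    Function.Surjective (doubleCentralizerMap C (cornerIdeal e)) := by
  intro φ
  let e' : cornerIdeal e := ⟨e, self_mem_cornerIdeal he⟩
  -- Characterizing the image y of x by y(ce) = φ(xce) avoids choosing a decomposition of x;
  -- vanishing of Ext^0 makes y unique, hence additive and C-linear in x.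
  have hex (x : C) (hx : x ∈ idealOf e) :
      ∃ y, ∀ c, y * (c * e) = φ (cornerMulLeft e (x * c)) e' := by
    induction hx using Submodule.span_induction with
    | mem x hx =>
      obtain ⟨a, b, rfl⟩ := hx
      refine ⟨φ (cornerMulLeft e a) ⟨e * b, mul_mem_cornerIdeal he b⟩, fun c => ?_⟩
      let s : Module.End Cᵐᵒᵖ (cornerIdeal e) :=
        { toFun := fun p => ⟨e * (b * c * p), mul_mem_cornerIdeal he _⟩
          map_add' := fun p q => by ext; simp [mul_add]
          map_smul' := fun d p => by ext; simp [mul_assoc] }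
      have hs : cornerMulLeft e (a * e * b * c) = DomMulAct.mk s • cornerMulLeft e a := by
        ext p
        simp [s, DomMulAct.mk_smul_linearMap_apply, mul_assoc]
      rw [hs, map_smul, DomMulAct.mk_smul_linearMap_apply, ← op_smul_eq_mul,
        ← map_smul]
      congr 1
      ext
      simp [s, e', mul_assoc]
    | zero =>
      refine ⟨0, fun c => ?_⟩
      have : cornerMulLeft e (0 * c) = 0 := by ext; simp
      rw [this]
      simp
    | add x y _ _ hx hy =>
      obtain ⟨x', hx'⟩ := hx
      obtain ⟨y', hy'⟩ := hy
      refine ⟨x' + y', fun c => ?_⟩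
      have : cornerMulLeft e ((x + y) * c) = cornerMulLeft e (x * c) + cornerMulLeft e (y * c) := by
        ext
        simp [add_mul]
      rw [add_mul, hx', hy', this, map_add]
      rfl
    | smul d x _ hx =>
      obtain ⟨x', hx'⟩ := hx
      refine ⟨x' * d.unop, fun c => ?_⟩
      rw [mul_assoc, ← mul_assoc d.unop, hx', MulOpposite.smul_eq_mul_unop, mul_assoc]
  choose ψ hψ using fun x : idealOf e => hex x x.2
  let Ψ : idealOf e →ₗ[Cᵐᵒᵖ] C :=
    { toFun := ψ
      map_add' := fun x y => by
        rw [← sub_eq_zero]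
        refine eq_zero_of_mul_idealOf_eq_zero h₀ fun a => ?_
        have : cornerMulLeft e ((x + y : idealOf e) * a) =
            cornerMulLeft e (x * a) + cornerMulLeft e (y * a) := by
          ext
          simp [add_mul]
        rw [sub_mul, add_mul, hψ, hψ, hψ, this, map_add, LinearMap.add_apply, sub_self]
      map_smul' := fun d x => by
        rw [← sub_eq_zero]
        refine eq_zero_of_mul_idealOf_eq_zero h₀ fun a => ?_
        rw [RingHom.id_apply, MulOpposite.smul_eq_mul_unop, sub_mul, mul_assoc,
          ← mul_assoc d.unop, hψ, hψ, Submodule.coe_smul, MulOpposite.smul_eq_mul_unop, mul_assoc,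
          sub_self] }
  obtain ⟨r, hr⟩ := exists_extension_of_subsingleton_ext (idealOf e).injective_subtype
    (LinearMap.exact_subtype_mkQ (idealOf e)) (idealOf e).mkQ_surjective h₁ Ψ
  refine ⟨r 1, ?_⟩
  ext g p
  have hr' (x : C) : r x = r 1 * x := by
    rw [← op_smul_eq_mul, ← map_smul, op_smul_eq_mul, one_mul]
  have hge : g e' * e = g e' := (apply_eq_apply_self_mul he g e').symm
  have hmem : g e' ∈ idealOf e := by
    simpa [hge] using mul_mul_mem_idealOf (e := e) (g e') 1
  have hψg : r 1 * g e' = ψ ⟨g e', hmem⟩ := by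
    rw [← hr']
    exact LinearMap.congr_fun hr ⟨g e', hmem⟩
  have hg : cornerMulLeft e (g e' * 1) = g := by
    ext x
    rw [mul_one]
    exact (apply_eq_apply_self_mul he g x).symm
  have hφ := hψ ⟨g e', hmem⟩ 1
  rw [hg, one_mul, ← hψg] at hφ
  change r 1 * g p = φ g p
  rw [apply_eq_apply_self_mul he g p, apply_eq_apply_self_mul he (φ g) p]
  change r 1 * (g e' * p) = φ g e' * p
  rw [← hφ, mul_assoc, mul_assoc, show e * p.1 = p from p.2]

theorem isWedderburnProjective_cornerIdeal (he : IsIdempotentElem e)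
    (h₀ : Subsingleton (RightExt C (MoritaDefect e) C 0))
    (h₁ : Subsingleton (RightExt C (MoritaDefect e) C 1)) :
    IsWedderburnProjective C (cornerIdeal e) := by
  let p : Cᵐᵒᵖ →ₗ[Cᵐᵒᵖ] cornerIdeal e :=
    LinearMap.toSpanSingleton Cᵐᵒᵖ _ ⟨e, self_mem_cornerIdeal he⟩
  let s : cornerIdeal e →ₗ[Cᵐᵒᵖ] Cᵐᵒᵖ :=
    { toFun := fun x => MulOpposite.op x.1
      map_add' := fun _ _ => rfl
      map_smul' := fun _ _ => rfl }
  have hps (x : cornerIdeal e) : p (s x) = x := Subtype.ext x.2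
  exact
    { finite := Module.Finite.of_surjective p fun x => ⟨s x, hps x⟩
      projective := Module.Projective.of_split s p (LinearMap.ext hps)
      bijective := ⟨doubleCentralizerMap_cornerIdeal_injective he h₀,
        doubleCentralizerMap_cornerIdeal_surjective he h₀ h₁⟩ }

end Corner

theorem idempotentNakayama_of_idempotentNakayamaPrime (h : IdempotentNakayamaPrime.{u}) :
    IdempotentNakayama.{u} := fun C _ hC e he hExt => by
  have htr := traceIdeal_cornerIdeal he.idempotent
  rw [subsingleton_quotient_iff_one_mem, ← htr, ← isGenerator_iff_one_mem_traceIdeal]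
  refine h C hC _ (isWedderburnProjective_cornerIdeal he.idempotent (hExt 0) (hExt 1)) ?_
  rw [htr]
  exact hExt

/-! ### Finiteness of endomorphism rings and duals. -/

section Finiteness

variable {A M : Type u} [Ring A] [AddCommGroup M] [Module Aᵐᵒᵖ M]

theorem finite_of_finite_mulOpposite {K : Type u} [CommRing K] [Algebra K A] [Module.Finite K A]
    [Module K M] [IsScalarTower K Aᵐᵒᵖ M] [Module.Finite Aᵐᵒᵖ M] : Module.Finite K M :=
  have : Module.Finite K Aᵐᵒᵖ := Module.Finite.equiv (MulOpposite.opLinearEquiv K)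
  Module.Finite.trans Aᵐᵒᵖ M

theorem IsNoetherianAlgebra.moduleEnd (hA : IsNoetherianAlgebra A) (hM : Module.Finite Aᵐᵒᵖ M) :
    IsNoetherianAlgebra (Module.End Aᵐᵒᵖ M) := by
  obtain ⟨K, _, _, hK, hKA⟩ := hA
  let _ : Module K M := Module.compHom M (algebraMap K Aᵐᵒᵖ)
  have hsmul (k : K) (x : M) : k • x = algebraMap K Aᵐᵒᵖ k • x := rfl
  have : IsScalarTower K Aᵐᵒᵖ M := ⟨fun k a x => by
    rw [Algebra.smul_def, mul_smul, hsmul]⟩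
  have : SMulCommClass Aᵐᵒᵖ K M := ⟨fun a k x => by
    rw [hsmul, hsmul, ← mul_smul, ← mul_smul, Algebra.commutes]⟩
  have : SMulCommClass K Aᵐᵒᵖ M := SMulCommClass.symm _ _ _
  have : Module.Finite K M := finite_of_finite_mulOpposite (A := A)
  refine ⟨K, inferInstance, inferInstance, hK, ?_⟩
  -- End_A(M) is a K-submodule of the noetherian K-module End_K(M).
  exact Module.Finite.of_injective (LinearMap.restrictScalarsₗ K Aᵐᵒᵖ M M K)
    (LinearMap.restrictScalars_injective K)

variable (A M) in
/-- The dual `Hom_A(M, A)` of a right `A`-module `M` as a right `End_A(M)`-module. -/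
instance instModuleEndDual : Module (Module.End Aᵐᵒᵖ M)ᵐᵒᵖ (M →ₗ[Aᵐᵒᵖ] A) :=
  inferInstanceAs (Module (Module.End Aᵐᵒᵖ M)ᵈᵐᵃ (M →ₗ[Aᵐᵒᵖ] A))

instance : SMulCommClass A (Module.End Aᵐᵒᵖ M)ᵐᵒᵖ (M →ₗ[Aᵐᵒᵖ] A) :=
  ⟨fun _ _ _ => rfl⟩

theorem IsNoetherianAlgebra.finite_dual (hA : IsNoetherianAlgebra A)
    (hM : Module.Finite Aᵐᵒᵖ M) :
    Module.Finite (Module.End Aᵐᵒᵖ M)ᵐᵒᵖ (M →ₗ[Aᵐᵒᵖ] A) := by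
  obtain ⟨K, _, _, hK, hKA⟩ := hA
  let _ : Module K M := Module.compHom M (algebraMap K Aᵐᵒᵖ)
  have hsmul (k : K) (x : M) : k • x = algebraMap K Aᵐᵒᵖ k • x := rfl
  have : IsScalarTower K Aᵐᵒᵖ M := ⟨fun k a x => by
    rw [Algebra.smul_def, mul_smul, hsmul]⟩
  have : SMulCommClass Aᵐᵒᵖ K M := ⟨fun a k x => by
    rw [hsmul, hsmul, ← mul_smul, ← mul_smul, Algebra.commutes]⟩
  have : SMulCommClass K Aᵐᵒᵖ M := SMulCommClass.symm _ _ _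
  have : Module.Finite K M := finite_of_finite_mulOpposite (A := A)
  have : IsScalarTower K Aᵐᵒᵖ A := ⟨fun k a x => by
    simp [MulOpposite.smul_eq_mul_unop]⟩
  have : IsNoetherian K A := isNoetherian_of_isNoetherianRing_of_finite K A
  have : Module.Finite K (M →ₗ[Aᵐᵒᵖ] A) :=
    Module.Finite.of_injective (LinearMap.restrictScalarsₗ K Aᵐᵒᵖ M A K)
      (LinearMap.restrictScalars_injective K)
  have : IsScalarTower K (Module.End Aᵐᵒᵖ M)ᵐᵒᵖ (M →ₗ[Aᵐᵒᵖ] A) := ⟨fun k a f => by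
    ext x
    exact f.map_smul_of_tower k _⟩
  exact Module.Finite.of_restrictScalars_finite K _ _

end Finiteness

/-! ### From (INC) to (GNC): the endomorphism ring of A × M. -/

section EndomorphismContext

variable (A M : Type u) [Ring A] [AddCommGroup M] [Module Aᵐᵒᵖ M]

/-- The idempotent of `End_A(A × M)` which is the projection onto the first factor. -/
def fstIdempotent : Module.End Aᵐᵒᵖ (A × M) :=
  LinearMap.inl Aᵐᵒᵖ A M ∘ₗ LinearMap.fst Aᵐᵒᵖ A M

@[simp]
theorem fstIdempotent_apply (x : A × M) : fstIdempotent A M x = (x.1, 0) := rfl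

theorem isIdempotentElem_fstIdempotent : IsIdempotentElem (fstIdempotent A M) := rfl

/-- Evaluation at (1, 0) identifies Ce with A × M, so one dual basis vector suffices. Lifting works
because elements of CeC are sums of endomorphisms factoring through the free module A. -/
theorem isTraceContext_fstIdempotent :
    IsTraceContext A (A × M) (idealOf (fstIdempotent A M)) where
  dual_basis := by
    let φ : (A × M) →ₗ[Module.End Aᵐᵒᵖ (A × M)] Module.End Aᵐᵒᵖ (A × M) :=
      { toFun := fun x => toRightModule x ∘ₗ LinearMap.fst Aᵐᵒᵖ A M
        map_add' := fun x y => LinearMap.ext fun z => smul_add (MulOpposite.op z.1) x y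
        map_smul' := fun c x => LinearMap.ext fun z => (map_smul c _ x).symm }
    refine ⟨1, fun _ => (1, 0), fun _ => φ, fun x => ?_, fun _ x => ?_⟩
    · rw [Fin.sum_univ_one]
      exact one_smul Aᵐᵒᵖ x
    · exact (show φ x * fstIdempotent A M * 1 = φ x from rfl) ▸ mul_mul_mem_idealOf (φ x) 1
  lifts t ht Y₁ Y₂ _ _ _ _ p hp f := by
    induction ht using Submodule.span_induction with
    | mem t ht =>
      obtain ⟨a, b, rfl⟩ := ht
      obtain ⟨y, hy⟩ := hp (f (a (1, 0)))
      refine ⟨toRightModule y ∘ₗ LinearMap.fst Aᵐᵒᵖ A M ∘ₗ b, fun x => ?_⟩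
      change p (MulOpposite.op (b x).1 • y) = f (a ((b x).1, 0))
      rw [map_smul, hy, ← map_smul, ← map_smul]
      simp
    | zero => exact ⟨0, fun x => by simp⟩
    | add s t _ _ hs ht =>
      obtain ⟨g, hg⟩ := hs
      obtain ⟨g', hg'⟩ := ht
      exact ⟨g + g', fun x => by rw [LinearMap.add_apply, map_add, hg, hg', add_smul, map_add]⟩
    | smul c t _ ht =>
      obtain ⟨g, hg⟩ := ht
      exact ⟨g ∘ₗ c.unop, fun x => hg _⟩
  faithful c hc := LinearMap.ext hc
  full f := ⟨f, fun _ => rfl⟩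

variable {A M}

/-- Write 1 = (1 - e) + e; as M is a generator, e is a sum of maps factoring through M, the image of
1 - e. -/
theorem IsGenerator.one_mem_idealOf (h : IsGenerator A M) :
    (1 : Module.End Aᵐᵒᵖ (A × M)) ∈ idealOf (1 - fstIdempotent A M) := by
  obtain ⟨n, f, x, hfx⟩ := isGenerator_iff_exists_sum.1 h
  have h1 : (1 : Module.End Aᵐᵒᵖ (A × M)) = 1 * (1 - fstIdempotent A M) * 1 +
      ∑ k, (LinearMap.inl Aᵐᵒᵖ A M ∘ₗ f k ∘ₗ LinearMap.snd Aᵐᵒᵖ A M) *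
        (1 - fstIdempotent A M) *
        (LinearMap.inr Aᵐᵒᵖ A M ∘ₗ toRightModule (x k) ∘ₗ LinearMap.fst Aᵐᵒᵖ A M) := by
    refine LinearMap.ext fun y => ?_
    ext
    · simp [LinearMap.sum_apply, Prod.fst_sum, ← Finset.sum_mul, hfx]
    · simp [LinearMap.sum_apply, Prod.snd_sum]
  refine Eq.mpr (congrArg (· ∈ _) h1) ?_
  exact Submodule.add_mem _ (mul_mul_mem_idealOf _ _)
    (Submodule.sum_mem _ fun k _ => mul_mul_mem_idealOf _ _)

/-- A is a direct summand of Mⁿ, so A × M is one of Mⁿ⁺¹. -/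
theorem IsGenerator.subsingleton_ext_prod (h : IsGenerator A M) (i : ℕ)
    (hM : Subsingleton (RightExt A M M i)) :
    Subsingleton (RightExt A (A × M) (A × M) i) := by
  obtain ⟨n, f, x, hfx⟩ := isGenerator_iff_exists_sum.1 h
  refine subsingleton_ext_of_sum_eq_id
    (Fin.cons (LinearMap.snd Aᵐᵒᵖ A M) fun k => toRightModule (x k) ∘ₗ LinearMap.fst Aᵐᵒᵖ A M)
    (Fin.cons (LinearMap.inr Aᵐᵒᵖ A M) fun k => LinearMap.inl Aᵐᵒᵖ A M ∘ₗ f k) ?_ i hM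
  rw [Fin.sum_univ_succ]
  refine LinearMap.ext fun y => ?_
  ext
  · simp [LinearMap.sum_apply, Prod.fst_sum, ← Finset.sum_mul, hfx]
  · simp [LinearMap.sum_apply, Prod.snd_sum]

end EndomorphismContext

theorem generalizedNakayama_of_idempotentNakayama (h : IdempotentNakayama.{u}) :
    GeneralizedNakayama.{u} := fun A _ hA M _ _ hfin hgen hExt => by
  have hctx := isTraceContext_fstIdempotent A M
  have hC := hctx.subsingleton_ext_iff.2 fun i hi => hgen.subsingleton_ext_prod i (hExt i hi)
  have := finite_self A
  have hW : IsWedderburnContext (fstIdempotent A M) :=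
    { idempotent := isIdempotentElem_fstIdempotent A M
      defect_compl := subsingleton_quotient_iff_one_mem.2 hgen.one_mem_idealOf
      two_le_grade := le_iInf₂ fun i hi =>
        absurd (hC i) (not_subsingleton_iff_nontrivial.2 hi) }
  have h1 := subsingleton_quotient_iff_one_mem.1 (h _ (hA.moduleEnd inferInstance) _ hW hC)
  have := hctx.projective_of_one_mem h1
  exact Module.Projective.of_split (LinearMap.inr Aᵐᵒᵖ A M) (LinearMap.snd Aᵐᵒᵖ A M) (by ext; rfl)

/-! ### From (GNC) to (INC'): the dual of a Wedderburn projective. -/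

section DualContext

variable {B N : Type u} [Ring B] [AddCommGroup N] [Module Bᵐᵒᵖ N]

variable (B N) in
/-- The `End_B(N)`-linear map `Hom_B(N, B) → End_B(N)`, `f ↦ (x ↦ n f(x))`. -/
def dualToEnd (n : N) :
    (N →ₗ[Bᵐᵒᵖ] B) →ₗ[(Module.End Bᵐᵒᵖ N)ᵐᵒᵖ] Module.End Bᵐᵒᵖ N where
  toFun f := toRightModule n ∘ₗ f
  map_add' f g := by
    ext x
    exact add_smul (MulOpposite.op (f x)) (MulOpposite.op (g x)) n
  map_smul' _ _ := rfl

theorem exists_dual_basis [Module.Finite Bᵐᵒᵖ N] [Module.Projective Bᵐᵒᵖ N] :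
    ∃ (k : ℕ) (n : Fin k → N) (f : Fin k → N →ₗ[Bᵐᵒᵖ] B),
      ∀ x, ∑ i, MulOpposite.op (f i x) • n i = x := by
  obtain ⟨k, p, hp⟩ := Module.Finite.exists_fin' Bᵐᵒᵖ N
  obtain ⟨s, hs⟩ := Module.projective_lifting_property p LinearMap.id hp
  refine ⟨k, fun i => p (Pi.single i 1), fun i =>
    { toFun := fun x => (s x i).unop
      map_add' := fun x y => by simp
      map_smul' := fun c x => by simp [MulOpposite.smul_eq_mul_unop] }, fun x => ?_⟩
  change ∑ i, s x i • p (Pi.single i 1) = x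
  simp_rw [← map_smul]
  rw [← map_sum]
  refine Eq.trans (congrArg p ?_) (LinearMap.congr_fun hs x)
  ext j
  simp [Finset.sum_apply, Pi.single_apply]

theorem isGenerator_dual [Module.Finite Bᵐᵒᵖ N] [Module.Projective Bᵐᵒᵖ N] :
    IsGenerator (Module.End Bᵐᵒᵖ N) (N →ₗ[Bᵐᵒᵖ] B) := by
  obtain ⟨k, n, f, hnf⟩ := exists_dual_basis (B := B) (N := N)
  refine isGenerator_iff_exists_sum.2 ⟨k, fun i => dualToEnd B N (n i), f, ?_⟩
  ext x
  rw [LinearMap.sum_apply]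
  exact hnf x

/-- The dual basis over B consists of the functionals fᵢ and the evaluations at nᵢ, whose values are
in the trace ideal. Bijectivity of the double centralizer map gives `faithful` and `full`. -/
theorem IsWedderburnProjective.isTraceContext (hN : IsWedderburnProjective B N) :
    IsTraceContext (Module.End Bᵐᵒᵖ N) (N →ₗ[Bᵐᵒᵖ] B) (traceIdeal B N) where
  dual_basis := by
    have := hN.finite
    have := hN.projective
    obtain ⟨k, n, f, hnf⟩ := exists_dual_basis (B := B) (N := N)
    refine ⟨k, f, fun i =>
      { toFun := fun g => g (n i)
        map_add' := fun _ _ => rfl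
        map_smul' := fun _ _ => rfl }, fun g => ?_, fun i g => apply_mem_traceIdeal g (n i)⟩
    ext x
    rw [LinearMap.sum_apply]
    conv_rhs => rw [← hnf x, map_sum]
    refine Finset.sum_congr rfl fun i _ => ?_
    rw [map_smul, op_smul_eq_mul]
    rfl
  lifts t ht Y₁ Y₂ _ _ _ _ p hp q := by
    induction ht using Submodule.iSup_induction' with
    | mem f t ht =>
      obtain ⟨n, rfl⟩ := ht
      obtain ⟨y, hy⟩ := hp (q f)
      -- Since f(n)g = f ∘ (x ↦ n g(x)), the action of f(n) factors through the free module
      -- End_B(N), so lifting q(f) suffices.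
      refine ⟨toRightModule y ∘ₗ dualToEnd B N n, fun g => ?_⟩
      change p (MulOpposite.op (dualToEnd B N n g) • y) = q (f n • g)
      rw [map_smul, hy, ← map_smul]
      congr 1
      ext x
      exact map_smul f (MulOpposite.op (g x)) n
    | zero => exact ⟨0, fun x => by simp⟩
    | add s t _ _ hs ht =>
      obtain ⟨g, hg⟩ := hs
      obtain ⟨g', hg'⟩ := ht
      exact ⟨g + g', fun x => by rw [LinearMap.add_apply, map_add, hg, hg', add_smul, map_add]⟩
  faithful c hc := (injective_iff_map_eq_zero _).1 hN.bijective.1 c (LinearMap.ext hc)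
  full f := by
    let f' : Module.End (Module.End Bᵐᵒᵖ N)ᵈᵐᵃ (N →ₗ[Bᵐᵒᵖ] B) :=
      { toFun := f, map_add' := f.map_add, map_smul' := f.map_smul }
    obtain ⟨c, hc⟩ := hN.bijective.2 f'
    exact ⟨c, fun x => (LinearMap.congr_fun hc x).symm⟩

end DualContext

theorem idempotentNakayamaPrime_of_generalizedNakayama (h : GeneralizedNakayama.{u}) :
    IdempotentNakayamaPrime.{u} := fun B _ hB N _ _ hN hExt => by
  have hctx := hN.isTraceContext
  have := hN.finite
  have := hN.projective
  have hfin := hB.finite_dual hN.finite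
  exact isGenerator_iff_one_mem_traceIdeal.2 <| hctx.one_mem_of_projective hfin <|
    h _ (hB.moduleEnd hN.finite) _ hfin isGenerator_dual (hctx.subsingleton_ext_iff.1 hExt)

end NakayamaConjectures

theorem proposition3 :
    (NakayamaConjectures.StrongNakayama.{u} → NakayamaConjectures.IdempotentNakayamaPrime.{u}) ∧
    (NakayamaConjectures.IdempotentNakayamaPrime.{u} ↔
      NakayamaConjectures.IdempotentNakayama.{u}) ∧
    (NakayamaConjectures.IdempotentNakayama.{u} ↔
      NakayamaConjectures.GeneralizedNakayama.{u}) :=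
  ⟨NakayamaConjectures.idempotentNakayamaPrime_of_strongNakayama,
    ⟨NakayamaConjectures.idempotentNakayama_of_idempotentNakayamaPrime, fun h =>
      NakayamaConjectures.idempotentNakayamaPrime_of_generalizedNakayama
        (NakayamaConjectures.generalizedNakayama_of_idempotentNakayama h)⟩,
    ⟨NakayamaConjectures.generalizedNakayama_of_idempotentNakayama, fun h =>
      NakayamaConjectures.idempotentNakayama_of_idempotentNakayamaPrime
        (NakayamaConjectures.idempotentNakayamaPrime_of_generalizedNakayama h)⟩⟩
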